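/- All graphs are finite and simple. For a graph $G$ and an integer $k\ge 1$, a $k$-colouring of $G$ is a map $\alpha\colon V(G)\to\{1,\dots,k\}$ with $\alpha(u)\ne\alpha(v)$ for every edge $uv$ of $G$, and $\chi(G)$ is the chromatic number of $G$. The reconfiguration graph $\mathcal R_k(G)$ has the $k$-colourings of $G$ as its vertices, two of them being adjacent if they differ in colour on exactly one vertex; $G$ is $k$-mixing if $\mathcal R_k(G)$ is connected. A graph $G$ is $H$-free if no induced subgraph of $G$ is isomorphic to $H$. Let $P_n$ be the path on $n$ vertices and let $P_3+P_1$ be the disjoint union of $P_3$ and $P_1$. Theorem. Let $H$ be a graph. Then the following are equivalent: (i) every $H$-free graph $G$ is $\ell$-mixing for every integer $\ell\ge\chi(G)+1$; (ii) $H$ is isomorphic to an induced subgraph of $P_4$ or of $P_3+P_1$. -/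

import Mathlib

namespace SimpleGraph

/-- The reconfiguration graph of the `k`-colourings of `G`: its vertices are the proper colourings
of `G` with colour set `Fin k`, and two colourings are adjacent when they differ in colour on
exactly one vertex. -/
def reconfigurationGraph {V : Type*} (G : SimpleGraph V) (k : ℕ) :
    SimpleGraph (G.Coloring (Fin k)) where
  Adj α β := ∃! v, α v ≠ β v
  symm := ⟨fun _ _ ⟨v, hv, huniq⟩ => ⟨v, hv.symm, fun w hw => huniq w hw.symm⟩⟩
  loopless := ⟨fun _ ⟨_, hv, _⟩ => hv rfl⟩

/-- `G` is `k`-mixing if the reconfiguration graph of its `k`-colourings is connected. -/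
def IsMixing {V : Type*} (G : SimpleGraph V) (k : ℕ) : Prop :=
  (G.reconfigurationGraph k).Connected

/-- `G` is `H`-free if no induced subgraph of `G` is isomorphic to `H`. -/
def IsInducedFree {V W : Type*} (G : SimpleGraph V) (H : SimpleGraph W) : Prop :=
  ¬ H.IsIndContained G

end SimpleGraph

/-! Necessity: a colouring in which every vertex sees all other colours is isolated in the
reconfiguration graph, so a `k`-colourable graph with such a frozen `(k+1)`-colouring and a second
colouring must contain `H` (`isIndContained_of_frozen`). This is applied to two graphs. The 6-cycle
is bipartite and frozen under 012012. In `halfEdgeGraph`, colouring by the five edges of `K₄` minus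
an edge is frozen, while the four vertices already give a colouring. Its complement is the line
graph of a subdivision, which has no induced 4-cycle, so `halfEdgeGraph` has no induced `2K₂`. Hence
`H` is a `2K₂`-free induced subgraph of `C₆`, which forces it into `P₄` or `P₃ + P₁`.

Sufficiency: with a spare colour, all renamings of a fixed colouring `γ` are connected, so it is
enough to recolour an arbitrary `α` into some renaming of `γ`. Being recolourable is preserved by
disjoint unions and by joins, and `P₄`-free graphs are built from single vertices by these two
operations. A `(P₃ + P₁)`-free graph that is not a join either has no independent triple or is a
disjoint union of cliques, hence `P₄`-free. Without independent triples, an optimal `γ` has classes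
of size at most two, and a counting argument supplies a free colour whenever no class can be merged
directly. -/

namespace SimpleGraph

/-! ### Recolouring sequences and renaming of colours. -/

section Recolours

variable {V : Type*} {G : SimpleGraph V} {K C : Type*}

/-- `α` can be turned into `β` by changing the colour of one vertex at a time, through proper
colourings only. -/
def Recolours (α β : G.Coloring C) : Prop :=
  Relation.ReflTransGen (fun α β : G.Coloring C => ∃ v, ∀ w, w ≠ v → α w = β w) α β

namespace Recolours

lemma refl (α : G.Coloring C) : Recolours α α := Relation.ReflTransGen.refl

lemma trans {α β γ : G.Coloring C} (h : Recolours α β) (h' : Recolours β γ) : Recolours α γ :=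
  Relation.ReflTransGen.trans h h'

lemma symm {α β : G.Coloring C} (h : Recolours α β) : Recolours β α := by
  induction h with
  | refl => exact refl α
  | tail _ h ih =>
    obtain ⟨v, hv⟩ := h
    exact Relation.ReflTransGen.head ⟨v, fun w hw => (hv w hw).symm⟩ ih

lemma reachable {k : ℕ} {α β : G.Coloring (Fin k)} (h : Recolours α β) :
    (G.reconfigurationGraph k).Reachable α β := by
  induction h with
  | refl => exact Reachable.refl _
  | @tail δ ε _ h ih =>
    refine ih.trans ?_
    by_cases hδε : δ = ε
    · subst hδε; exact Reachable.refl _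
    · obtain ⟨v, hv⟩ := h
      refine Adj.reachable (⟨v, fun h => hδε ?_, fun w hw => ?_⟩ : ∃! v, δ v ≠ ε v)
      · ext w
        by_cases hw : w = v
        · rw [hw, h]
        · rw [hv w hw]
      · by_contra h'
        exact hw (hv w h')

/-- Two colourings that do not conflict along any edge are connected: the vertices on which they
differ can be recoloured in any order. -/
lemma of_compatible [Finite V] {α β : G.Coloring C} (h : ∀ u v, G.Adj u v → α u ≠ β v) :
    Recolours α β := by
  classical
  induction hn : {v | α v ≠ β v}.ncard using Nat.strong_induction_on generalizing α with
  | _ n ih =>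
    by_cases hαβ : ∃ v, α v ≠ β v
    · obtain ⟨v, hv⟩ := hαβ
      let c : V → C := Function.update α v (β v)
      let α' : G.Coloring C := Coloring.mk c (by
        intro u w huw
        simp only [c]
        by_cases hu : u = v
        · subst hu
          rw [Function.update_self, Function.update_of_ne huw.ne']
          exact (h w u huw.symm).symm
        · rw [Function.update_of_ne hu]
          by_cases hw : w = v
          · subst hw; rw [Function.update_self]; exact h u w huw
          · rw [Function.update_of_ne hw]; exact α.valid huw)
      have hself : α' v = β v := Function.update_self (β := fun _ => C) v (β v) α
      have hne : ∀ w, w ≠ v → α' w = α w := fun w hw =>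
        Function.update_of_ne (β := fun _ => C) hw (β v) α
      refine trans (Relation.ReflTransGen.single ⟨v, fun w hw => (hne w hw).symm⟩ :
        Recolours α α') (ih _ ?_ ?_ rfl)
      · rw [← hn]
        refine Set.ncard_lt_ncard ⟨fun w hw => ?_, fun hs => hs hv hself⟩ (Set.toFinite _)
        have hwv : w ≠ v := fun e => hw (by rw [e, hself])
        simpa only [Set.mem_ofPred_eq, hne w hwv] using hw
      · intro u w huw
        by_cases hu : u = v
        · rw [hu, hself]; exact β.valid (hu ▸ huw)
        · rw [hne u hu]; exact h u w huw
    · push Not at hαβ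
      rw [show α = β from DFunLike.ext _ _ hαβ]
      exact refl β

section Embedding

variable [Finite V] (γ : G.Coloring K)

/-- Since `c` is unused, a whole colour class can move to it without the old and new colourings
conflicting along an edge. -/
lemma setValue_of_notMem_range [DecidableEq K] [DecidableEq C] (f : K ↪ C) (k : K) {c : C}
    (hc : c ∉ Set.range f) :
    Recolours (G.recolorOfEmbedding f γ)
      (G.recolorOfEmbedding (f.setValue k c) γ) := by
  refine of_compatible fun u v huv => ?_
  have hγ := γ.valid huv
  change f (γ u) ≠ f.setValue k c (γ v)
  by_cases hv : γ v = k
  · rw [hv, Function.Embedding.setValue_eq]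
    exact fun h => hc ⟨_, h⟩
  · rw [Function.Embedding.setValue_eq_of_ne hv fun h => hc ⟨_, h⟩]
    exact fun h => hγ (f.injective h)

/-- If another class `k'` already has colour `c`, `Embedding.setValue` exchanges the two colours.
The exchange is done in three moves through a spare colour `d`: `k` to `d`, then `k'` to the old
colour of `k`, then `k` to `c`. -/
lemma setValue [DecidableEq K] [DecidableEq C] [Finite K] [Finite C]
    (hcard : Nat.card K < Nat.card C) (f : K ↪ C) (k : K) (c : C) :
    Recolours (G.recolorOfEmbedding f γ)
      (G.recolorOfEmbedding (f.setValue k c) γ) := by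
  by_cases hc : c ∈ Set.range f
  · obtain ⟨k', rfl⟩ := hc
    by_cases hk : k' = k
    · subst hk
      rw [show f.setValue k' (f k') = f by
        ext x; simp only [Function.Embedding.setValue, Function.Embedding.coeFn_mk]
        grind]
      exact refl _
    obtain ⟨d, hd⟩ : ∃ d, d ∉ Set.range f := by
      by_contra! h
      exact hcard.not_ge (Nat.card_le_card_of_surjective f h)
    have hdk : ∀ x, f x ≠ d := fun x hx => hd ⟨x, hx⟩
    refine (setValue_of_notMem_range γ f k hd).trans ?_
    refine (setValue_of_notMem_range γ (f.setValue k d) k' (c := f k) ?_).trans ?_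
    · rintro ⟨x, hx⟩
      by_cases hxk : x = k
      · rw [hxk, Function.Embedding.setValue_eq] at hx
        exact hdk k hx.symm
      · rw [Function.Embedding.setValue_eq_of_ne hxk (hdk x)] at hx
        exact hxk (f.injective hx)
    have hset : f.setValue k (f k') = ((f.setValue k d).setValue k' (f k)).setValue k (f k') := by
      ext x
      simp only [Function.Embedding.setValue, Function.Embedding.coeFn_mk]
      have := f.injective.eq_iff (a := x) (b := k)
      have := f.injective.eq_iff (a := x) (b := k')
      grind
    rw [hset]
    refine setValue_of_notMem_range γ ((f.setValue k d).setValue k' (f k)) k (c := f k') ?_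
    · rintro ⟨x, hx⟩
      simp only [Function.Embedding.setValue, Function.Embedding.coeFn_mk] at hx
      have := f.injective.eq_iff (a := x) (b := k)
      have := f.injective.eq_iff (a := x) (b := k')
      have := f.injective.eq_iff (a := k) (b := k')
      grind
  · exact setValue_of_notMem_range γ f k hc

/-- With a spare colour, the colours of a colouring can be renamed at will. -/
lemma recolorOfEmbedding [Finite K] [Finite C]
    (hcard : Nat.card K < Nat.card C) (f g : K ↪ C) :
    Recolours (G.recolorOfEmbedding f γ) (G.recolorOfEmbedding g γ) := by
  classical
  induction hn : {k | f k ≠ g k}.ncard using Nat.strong_induction_on generalizing f with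
  | _ n ih =>
    by_cases hfg : ∃ k, f k ≠ g k
    · obtain ⟨k, hk⟩ := hfg
      refine (setValue γ hcard f k (g k)).trans (ih _ ?_ _ rfl)
      rw [← hn]
      refine Set.ncard_lt_ncard ⟨fun x hx => ?_, fun hs => hs hk ?_⟩ (Set.toFinite _)
      · by_contra hfx
        simp only [Set.mem_ofPred_eq, not_not] at hfx
        refine hx ?_
        -- The exchange spoils no agreement: if `f x = g x` with `x ≠ k`, then `f x ≠ g k` by
        -- injectivity of `g`, so `x` is not the displaced class.
        by_cases hxk : x = k
        · rw [hxk, Function.Embedding.setValue_eq]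
        · rw [Function.Embedding.setValue_eq_of_ne hxk, hfx]
          exact fun h => hxk (g.injective (hfx.symm.trans h))
      · exact Function.Embedding.setValue_eq ..
    · push Not at hfg
      rw [show f = g from DFunLike.ext _ _ hfg]
      exact refl _

end Embedding

/-- A recolouring of an induced subgraph extends to the whole graph, as long as its colours do not
occur on the neighbours outside the subgraph. -/
lemma exists_extension {s : Set V} {P : Set C} {α : G.Coloring C}
    (hP : ∀ u ∈ s, ∀ v ∉ s, G.Adj u v → α v ∉ P) {δ ε : (G.induce s).Coloring P}
    (hδ : ∀ x : s, (δ x : C) = α x) (h : Recolours δ ε) :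
    ∃ β : G.Coloring C, Recolours α β ∧ (∀ x : s, β x = ε x) ∧ ∀ v ∉ s, β v = α v := by
  classical
  induction h with
  | refl => exact ⟨α, refl α, fun x => (hδ x).symm, fun _ _ => rfl⟩
  | @tail ε ε' _ h ih =>
    obtain ⟨β, hαβ, hβs, hβ⟩ := ih
    obtain ⟨x, hx⟩ := h
    let c : V → C := fun v => if hv : v ∈ s then ε' ⟨v, hv⟩ else α v
    have hcs : ∀ (v) (hv : v ∈ s), c v = ε' ⟨v, hv⟩ := fun v hv => dif_pos hv
    have hc : ∀ v ∉ s, c v = α v := fun v hv => dif_neg hv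
    let β' : G.Coloring C := Coloring.mk c (by
      intro u v huv
      by_cases hu : u ∈ s
      · by_cases hv : v ∈ s
        · rw [hcs u hu, hcs v hv]
          exact fun h => ε'.valid (v := ⟨u, hu⟩) (w := ⟨v, hv⟩) huv (Subtype.ext h)
        · rw [hcs u hu, hc v hv]
          exact fun h => hP u hu v hv huv (h ▸ (ε' ⟨u, hu⟩).2)
      · by_cases hv : v ∈ s
        · rw [hc u hu, hcs v hv]
          exact fun h => hP v hv u hu huv.symm (h ▸ (ε' ⟨v, hv⟩).2)
        · rw [hc u hu, hc v hv]
          exact α.valid huv)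
    refine ⟨β', hαβ.tail ⟨x, fun v hv => ?_⟩, fun y => hcs y y.2, hc⟩
    by_cases hvs : v ∈ s
    · refine (hβs ⟨v, hvs⟩).trans (Eq.trans ?_ (hcs v hvs).symm)
      rw [hx ⟨v, hvs⟩ fun h => hv (congrArg Subtype.val h)]
    · exact (hβ v hvs).trans (hc v hvs).symm

end Recolours

end Recolours

/-! ### Disjoint unions and joins. -/

section Recolourable

variable {V : Type*}

/-- All pairs of `C`-colourings of `G` are connected by recolourings, whenever `C` has more
elements than are needed to colour `G`. -/
def IsRecolourable (G : SimpleGraph V) : Prop :=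
  ∀ (K C : Type) [Finite K] [Finite C], G.Coloring K → Nat.card K < Nat.card C →
    ∀ α β : G.Coloring C, Recolours α β

variable {G : SimpleGraph V}

lemma IsRecolourable.isMixing (h : G.IsRecolourable) {ℓ : ℕ}
    (hℓ : G.chromaticNumber + 1 ≤ (ℓ : ℕ∞)) : G.IsMixing ℓ := by
  have hfin : G.chromaticNumber ≠ ⊤ := by
    intro h
    rw [h] at hℓ
    exact absurd hℓ (by simp)
  obtain ⟨n, hn⟩ := ENat.ne_top_iff_exists.mp hfin
  rw [← hn] at hℓ
  have hnℓ : n + 1 ≤ ℓ := by exact_mod_cast hℓ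
  have hcol : G.Colorable n := chromaticNumber_le_iff_colorable.mp hn.ge
  obtain ⟨δ⟩ := hcol.mono (by lia : n ≤ ℓ)
  obtain ⟨γ⟩ := hcol
  have : Nonempty (G.Coloring (Fin ℓ)) := ⟨δ⟩
  exact ⟨fun α β => (h (Fin n) (Fin ℓ) γ (by simpa using hnℓ) α β).reachable⟩

lemma isRecolourable_of_subsingleton [Subsingleton V] : G.IsRecolourable := by
  have : Finite V := Finite.of_subsingleton
  intro K C _ _ _ _ α β
  exact Recolours.of_compatible fun u v huv => (huv.ne (Subsingleton.elim u v)).elim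

/-- It suffices to reach renamings of one fixed colouring. -/
lemma recolours_of_forall_exists_embedding [Finite V] {K C : Type*} [Finite K] [Finite C]
    (γ : G.Coloring K) (hcard : Nat.card K < Nat.card C)
    (h : ∀ α : G.Coloring C, ∃ f : K ↪ C, Recolours α (G.recolorOfEmbedding f γ))
    (α β : G.Coloring C) : Recolours α β := by
  obtain ⟨f, hf⟩ := h α
  obtain ⟨g, hg⟩ := h β
  exact (hf.trans (Recolours.recolorOfEmbedding γ hcard f g)).trans hg.symm

/-- A graph without edges between `s` and its complement is recolourable if both parts are. -/
lemma isRecolourable_of_disjoint_parts {s : Set V} (hs : ∀ u ∈ s, ∀ v ∉ s, ¬ G.Adj u v)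
    (h₁ : (G.induce s).IsRecolourable) (h₂ : (G.induce sᶜ).IsRecolourable) :
    G.IsRecolourable := by
  intro K C _ _ γ hcard α β
  have hcard' : Nat.card K < Nat.card (Set.univ : Set C) := by
    rwa [Nat.card_congr (Equiv.Set.univ C)]
  -- No edge leaves either part, so the palette need not be restricted and `P = Set.univ` is
  -- allowed.
  let r (t : Set V) (δ : G.Coloring C) : (G.induce t).Coloring (Set.univ : Set C) :=
    Coloring.mk (fun x => ⟨δ x, trivial⟩) fun {u v} huv h =>
      δ.valid (v := u) (w := v) huv (congrArg Subtype.val h)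
  obtain ⟨α₁, hα₁, hα₁s, hα₁c⟩ := Recolours.exists_extension (s := s) (P := Set.univ) (α := α)
    (fun u hu v hv huv => (hs u hu v hv huv).elim) (δ := r s α) (ε := r s β) (fun _ => rfl)
    (h₁ K _ (γ.comp (Embedding.induce s).toHom) hcard' _ _)
  obtain ⟨α₂, hα₂, hα₂s, hα₂c⟩ := Recolours.exists_extension (s := sᶜ) (P := Set.univ) (α := α₁)
    (fun u hu v hv huv => (hs v (not_not.mp hv) u hu huv.symm).elim) (δ := r sᶜ α₁)
    (ε := r sᶜ β) (fun _ => rfl)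
    (h₂ K _ (γ.comp (Embedding.induce sᶜ).toHom) hcard' _ _)
  convert hα₁.trans hα₂
  refine DFunLike.ext _ _ fun v => ?_
  by_cases hv : v ∈ s
  · rw [hα₂c v (not_not.mpr hv)]
    exact (hα₁s ⟨v, hv⟩).symm
  · exact (hα₂s ⟨v, hv⟩).symm

/-- The step towards recolouring a join in which the part `s` has enough spare colours. -/
lemma exists_embedding_of_join [Finite V] {s t : Set V}
    (hst : ∀ v, v ∈ t ↔ v ∉ s)
    (h₁ : (G.induce s).IsRecolourable) (h₂ : (G.induce t).IsRecolourable)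
    {K₁ K₂ C : Type} [Finite K₁] [Finite K₂] [Finite C] (hs : ∀ u ∈ s, ∀ v ∈ t, G.Adj u v)
    (γ₁ : (G.induce s).Coloring K₁) (γ₂ : (G.induce t).Coloring K₂)
    (hcard : Nat.card K₁ + Nat.card K₂ < Nat.card C) (α : G.Coloring C)
    (hα : Nat.card K₁ < Nat.card ↥(α '' t)ᶜ) :
    ∃ (f₁ : K₁ ↪ C) (f₂ : K₂ ↪ C) (β : G.Coloring C), (∀ i j, f₁ i ≠ f₂ j) ∧ Recolours α β ∧
      (∀ x : s, β x = f₁ (γ₁ x)) ∧ ∀ x : ↥t, β x = f₂ (γ₂ x) := by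
  classical
  have := Fintype.ofFinite K₁
  have := Fintype.ofFinite K₂
  have := Fintype.ofFinite C
  set P : Set C := (α '' t)ᶜ with hP
  obtain ⟨f₁⟩ : Nonempty (K₁ ↪ P) := Function.Embedding.nonempty_of_card_le (by
    rw [← Nat.card_eq_fintype_card, ← Nat.card_eq_fintype_card]; exact hα.le)
  have hαP : ∀ x ∈ s, α x ∈ P := by
    rintro x hx ⟨y, hy, hyx⟩
    exact α.valid (hs x hx y hy) hyx.symm
  let δ₁ : (G.induce s).Coloring P := Coloring.mk (fun x => ⟨α x, hαP x x.2⟩)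
    fun {u v} huv h => α.valid (v := u) (w := v) huv (congrArg Subtype.val h)
  obtain ⟨α₁, hα₁, hα₁s, hα₁c⟩ := Recolours.exists_extension (s := s) (P := P) (α := α)
    (fun u _ v hv _ h => h ⟨v, (hst v).mpr hv, rfl⟩) (δ := δ₁) (fun _ => rfl)
    (h₁ K₁ P γ₁ hα _ ((G.induce s).recolorOfEmbedding f₁ γ₁))
  -- Now `s` occupies only the colours of `f₁`, so more than `Nat.card K₂` colours are available for
  -- `t`.
  set Q : Set C := (Set.range fun i => (f₁ i : C))ᶜ with hQ
  have hcardQ : Nat.card K₂ < Nat.card Q := by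
    have h1 : (Set.range fun i => (f₁ i : C)).ncard = Nat.card K₁ :=
      Set.ncard_range_of_injective (Subtype.val_injective.comp f₁.injective)
    have h2 := Set.ncard_add_ncard_compl (Set.range fun i => (f₁ i : C))
    rw [Nat.card_coe_set_eq]
    lia
  obtain ⟨f₂⟩ : Nonempty (K₂ ↪ Q) := Function.Embedding.nonempty_of_card_le (by
    rw [← Nat.card_eq_fintype_card, ← Nat.card_eq_fintype_card]; exact hcardQ.le)
  have hαQ : ∀ x ∈ t, α₁ x ∈ Q := by
    rintro x hx ⟨i, hi⟩
    exact (f₁ i).2 ⟨x, hx, by rw [← hα₁c x ((hst x).mp hx)]; exact hi.symm⟩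
  let δ₂ : (G.induce t).Coloring Q := Coloring.mk (fun x => ⟨α₁ x, hαQ x x.2⟩)
    fun {u v} huv h => α₁.valid (v := u) (w := v) huv (congrArg Subtype.val h)
  obtain ⟨α₂, hα₂, hα₂s, hα₂c⟩ := Recolours.exists_extension (s := t) (P := Q) (α := α₁)
    (fun u _ v hv _ h =>
      have hv' : v ∈ s := not_not.mp (mt (hst v).mpr hv)
      h ⟨γ₁ ⟨v, hv'⟩, (hα₁s ⟨v, hv'⟩).symm⟩) (δ := δ₂)
    (fun _ => rfl) (h₂ K₂ Q γ₂ hcardQ _ ((G.induce t).recolorOfEmbedding f₂ γ₂))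
  refine ⟨f₁.trans (Function.Embedding.subtype _), f₂.trans (Function.Embedding.subtype _), α₂,
    fun i j h => (f₂ j).2 ⟨i, h⟩, hα₁.trans hα₂, fun x => ?_, fun x => hα₂s x⟩
  rw [hα₂c x (mt (hst x).mp (not_not.mpr x.2))]
  exact hα₁s x

/-- The join of two recolourable graphs is recolourable. -/
lemma isRecolourable_of_join [Finite V] {s : Set V} (hs : ∀ u ∈ s, ∀ v ∉ s, G.Adj u v)
    (h₁ : (G.induce s).IsRecolourable) (h₂ : (G.induce sᶜ).IsRecolourable) :
    G.IsRecolourable := by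
  classical
  intro K C _ _ γ hcard
  have hdisj : ∀ u ∈ s, ∀ v ∉ s, γ u ≠ γ v := fun u hu v hv => γ.valid (hs u hu v hv)
  let K₁ := ↥(γ '' s)
  let K₂ := ↥(γ '' sᶜ)
  let γ₁ : (G.induce s).Coloring K₁ := Coloring.mk (fun x => ⟨γ x, x, x.2, rfl⟩)
    fun {u v} huv h => γ.valid (v := u) (w := v) huv (congrArg Subtype.val h)
  let γ₂ : (G.induce sᶜ).Coloring K₂ := Coloring.mk (fun x => ⟨γ x, x, x.2, rfl⟩)
    fun {u v} huv h => γ.valid (v := u) (w := v) huv (congrArg Subtype.val h)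
  have hcard' : Nat.card K₁ + Nat.card K₂ < Nat.card C := by
    refine lt_of_le_of_lt ?_ hcard
    rw [Nat.card_coe_set_eq, Nat.card_coe_set_eq, ← Set.ncard_union_eq, ← Set.ncard_univ]
    · exact Set.ncard_le_ncard (Set.subset_univ _)
    · rw [Set.disjoint_left]
      rintro _ ⟨u, hu, rfl⟩ ⟨v, hv, h⟩
      exact hdisj u hu v hv h.symm
  let c : V → K₁ ⊕ K₂ := fun v =>
    if hv : v ∈ s then Sum.inl (γ₁ ⟨v, hv⟩) else Sum.inr (γ₂ ⟨v, hv⟩)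
  have hcs : ∀ v (hv : v ∈ s), c v = Sum.inl (γ₁ ⟨v, hv⟩) := fun v hv => dif_pos hv
  have hcc : ∀ v (hv : v ∉ s), c v = Sum.inr (γ₂ ⟨v, hv⟩) := fun v hv => dif_neg hv
  let γ' : G.Coloring (K₁ ⊕ K₂) := Coloring.mk c (by
    intro u v huv
    by_cases hu : u ∈ s <;> by_cases hv : v ∈ s
    · rw [hcs u hu, hcs v hv]
      exact fun h => γ₁.valid (v := ⟨u, hu⟩) (w := ⟨v, hv⟩) huv (Sum.inl_injective h)
    · rw [hcs u hu, hcc v hv]; simp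
    · rw [hcc u hu, hcs v hv]; simp
    · rw [hcc u hu, hcc v hv]
      exact fun h => γ₂.valid (v := ⟨u, hu⟩) (w := ⟨v, hv⟩) huv (Sum.inr_injective h))
  refine recolours_of_forall_exists_embedding γ' (by rwa [Nat.card_sum]) fun α => ?_
  obtain ⟨f₁, f₂, β, hf, hαβ, hβ₁, hβ₂⟩ : ∃ (f₁ : K₁ ↪ C) (f₂ : K₂ ↪ C) (β : G.Coloring C),
      (∀ i j, f₁ i ≠ f₂ j) ∧ Recolours α β ∧
      (∀ x : s, β x = f₁ (γ₁ x)) ∧ ∀ x : ↥sᶜ, β x = f₂ (γ₂ x) := by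
    -- One side always has room: if `s` has not, then `α` uses at least `|C| - |K₁| > |K₂|` colours
    -- on `sᶜ`, and none of these occurs on `s`.
    by_cases hα : Nat.card K₁ < Nat.card ↥(α '' sᶜ)ᶜ
    · exact exists_embedding_of_join (fun _ => Iff.rfl) h₁ h₂ hs γ₁ γ₂ hcard' α hα
    · have hs' : ∀ u ∈ sᶜ, ∀ v ∈ s, G.Adj u v := fun u hu v hv => (hs v hv u hu).symm
      have hdisj : α '' sᶜ ⊆ (α '' s)ᶜ := by
        rintro _ ⟨v, hv, rfl⟩ ⟨u, hu, h⟩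
        exact α.valid (hs u hu v hv) h
      have hle : Nat.card ↥(α '' sᶜ)ᶜ ≤ Nat.card K₁ := not_lt.mp hα
      have hα' : Nat.card K₂ < Nat.card ↥(α '' s)ᶜ := by
        have h1 := Set.ncard_add_ncard_compl (α '' sᶜ)
        have h2 := Set.ncard_le_ncard hdisj
        rw [Nat.card_coe_set_eq (α '' sᶜ)ᶜ] at hle
        rw [Nat.card_coe_set_eq (α '' s)ᶜ]
        lia
      -- Having `t` as a separate set lets the roles be swapped with `s` itself in place of `sᶜᶜ`.
      obtain ⟨f₂, f₁, β, hf, hαβ, hβ₂, hβ₁⟩ := exists_embedding_of_join (t := s)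
        (fun v => not_not.symm) h₂ h₁ hs' γ₂ γ₁ (by lia) α hα'
      exact ⟨f₁, f₂, β, fun i j => (hf j i).symm, hαβ, hβ₁, hβ₂⟩
  refine ⟨⟨Sum.elim f₁ f₂, f₁.injective.sumElim f₂.injective hf⟩, ?_⟩
  convert hαβ
  refine DFunLike.ext _ _ fun v => ?_
  by_cases hv : v ∈ s
  · refine Eq.trans ?_ (hβ₁ ⟨v, hv⟩).symm
    change Sum.elim f₁ f₂ (c v) = _
    rw [hcs v hv]; rfl
  · refine Eq.trans ?_ (hβ₂ ⟨v, hv⟩).symm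
    change Sum.elim f₁ f₂ (c v) = _
    rw [hcc v hv]; rfl

end Recolourable

/-! ### Graphs without independent triples. -/

section Classes

/-- If the fibres of `γ` have at most two elements, and elements that are not alone in their fibre
of `γ` are not alone in their fibre of `α` either, then `α` takes at most as many values as `γ`. -/
lemma _root_.Set.ncard_range_le_of_fibers {V K C : Type*} [Finite V] [Finite K] [Finite C]
    (γ : V → K) (α : V → C)
    (hγ : ∀ x y z, γ x = γ y → γ x = γ z → x = y ∨ x = z ∨ y = z)
    (h : ∀ x y, y ≠ x → γ y = γ x → ∃ z, z ≠ x ∧ α z = α x) :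
    (Set.range α).ncard ≤ Nat.card K := by
  classical
  have := Fintype.ofFinite V
  have := Fintype.ofFinite K
  have := Fintype.ofFinite C
  -- Double counting: an element weighs 2 if alone in its class and 1 otherwise. Each nonempty class
  -- of `α` weighs at least 2, each class of `γ` at most 2, and `h` gives `w ≤ w'`.
  let w (x : V) : ℕ := if ∃ y, y ≠ x ∧ α y = α x then 1 else 2
  let w' (x : V) : ℕ := if ∃ y, y ≠ x ∧ γ y = γ x then 1 else 2
  have hw : ∀ x, w x ≤ w' x := by
    intro x
    by_cases hx : ∃ y, y ≠ x ∧ γ y = γ x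
    · obtain ⟨y, hy, hyx⟩ := hx
      have := h x y hy hyx
      simp only [w, if_pos this, w']
      split_ifs <;> simp
    · simp only [w, w', if_neg hx]
      split_ifs <;> simp
  have hα : 2 * (Finset.univ.image α).card ≤ ∑ x, w x := by
    rw [← Finset.sum_fiberwise_of_maps_to (t := Finset.univ.image α) (g := α) (by simp), mul_comm,
      ← smul_eq_mul]
    refine Finset.card_nsmul_le_sum _ _ _ fun c hc => ?_
    obtain ⟨x, -, rfl⟩ := Finset.mem_image.mp hc
    by_cases hx : ∃ y, y ≠ x ∧ α y = α x
    · obtain ⟨y, hy, hyx⟩ := hx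
      have hle : ∑ z ∈ ({x, y} : Finset V), w z ≤ ∑ z with α z = α x, w z :=
        Finset.sum_le_sum_of_subset (by intro z; simp; rintro (rfl | rfl) <;> simp [hyx])
      rw [Finset.sum_pair hy.symm] at hle
      have hx : 1 ≤ w x := by simp only [w]; split_ifs <;> simp
      have hy : 1 ≤ w y := by simp only [w]; split_ifs <;> simp
      lia
    · have hle := Finset.single_le_sum (f := w) (s := Finset.univ.filter fun z => α z = α x)
        (fun _ _ => Nat.zero_le _) (a := x) (by simp)
      simpa only [w, if_neg hx] using hle
  have hγ' : ∑ x, w' x ≤ 2 * Fintype.card K := by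
    rw [← Finset.sum_fiberwise (g := γ), mul_comm, ← smul_eq_mul, ← Finset.card_univ]
    refine Finset.sum_le_card_nsmul _ _ _ fun k _ => ?_
    by_cases hk : ∃ x, γ x = k ∧ ¬ ∃ y, y ≠ x ∧ γ y = γ x
    · obtain ⟨x, rfl, hx⟩ := hk
      have : (Finset.univ.filter fun z => γ z = γ x) = {x} := by
        ext z
        simp only [Finset.mem_filter, Finset.mem_univ, true_and, Finset.mem_singleton]
        refine ⟨fun hz => ?_, fun hz => by rw [hz]⟩
        by_contra hzx
        exact hx ⟨z, hzx, hz⟩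
      rw [this, Finset.sum_singleton]
      simp only [w']; split_ifs; simp
    · push Not at hk
      calc ∑ x with γ x = k, w' x = ∑ x with γ x = k, 1 := by
            refine Finset.sum_congr rfl fun x hx => if_pos ?_
            exact hk x (Finset.mem_filter.mp hx).2
        _ = (Finset.univ.filter fun x => γ x = k).card := by simp
        _ ≤ 2 := by
            by_contra! hlt
            obtain ⟨x, hx, y, hy, z, hz, hxy, hxz, hyz⟩ := Finset.two_lt_card.mp hlt
            simp only [Finset.mem_filter, Finset.mem_univ, true_and] at hx hy hz
            have := hγ x y z (hx.trans hy.symm) (hx.trans hz.symm)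
            tauto
  have hsum : ∑ x, w x ≤ ∑ x, w' x := Finset.sum_le_sum fun x _ => hw x
  have hr : (Set.range α).ncard = (Finset.univ.image α).card := by
    rw [← Set.ncard_coe_finset]; simp
  rw [hr, Nat.card_eq_fintype_card]
  lia

variable {V : Type*} {G : SimpleGraph V}

/-- A colouring with the least number of colours uses all of them. -/
lemma Coloring.le_ncard_range {K : Type*} [Finite K] (δ : G.Coloring K) {n : ℕ}
    (hn : ∀ m, G.Colorable m → n ≤ m) : n ≤ (Set.range δ).ncard := by
  have := Fintype.ofFinite ↥(Set.range δ)
  have h : G.Coloring ↥(Set.range δ) :=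
    Coloring.mk (fun v => ⟨δ v, v, rfl⟩) fun huv h => δ.valid huv (congrArg Subtype.val h)
  rw [← Nat.card_coe_set_eq, Nat.card_eq_fintype_card]
  exact hn _ h.colorable

/-- Graphs without an independent set of size three are recolourable. -/
lemma isRecolourable_of_no_independent_triple [Finite V]
    (h : ∀ x y z, x ≠ y → x ≠ z → y ≠ z → G.Adj x y ∨ G.Adj x z ∨ G.Adj y z) :
    G.IsRecolourable := by
  classical
  intro K₀ C _ _ γ₀ hcard
  have := Fintype.ofFinite K₀
  -- The given `γ₀` may waste colours; the final renaming is injective only for an optimal `γ`.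
  have hex : ∃ n, G.Colorable n := ⟨_, γ₀.colorable⟩
  let n := Nat.find hex
  obtain ⟨γ⟩ : G.Colorable n := Nat.find_spec hex
  have hmin : ∀ m, G.Colorable m → n ≤ m := fun m hm => Nat.find_min' hex hm
  have hnC : Nat.card (Fin n) < Nat.card C := by
    refine lt_of_le_of_lt ?_ hcard
    rw [Nat.card_fin, Nat.card_eq_fintype_card]
    exact hmin _ γ₀.colorable
  have hγ : ∀ x y z, γ x = γ y → γ x = γ z → x = y ∨ x = z ∨ y = z := by
    intro x y z hxy hxz
    by_contra! hne
    rcases h x y z hne.1 hne.2.1 hne.2.2 with h | h | h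
    · exact γ.valid h hxy
    · exact γ.valid h hxz
    · exact γ.valid h (hxy.symm.trans hxz)
  refine recolours_of_forall_exists_embedding γ hnC fun α => ?_
  -- The potential: pairs that `γ` puts together and `α` separates. Recolouring one vertex of such a
  -- pair creates no new one, as `γ`-classes have at most two elements.
  let D (α : G.Coloring C) : Set (V × V) := {p | γ p.1 = γ p.2 ∧ α p.1 ≠ α p.2}
  have hD : ∀ (α β : G.Coloring C) (x y), γ x = γ y → α x ≠ α y → (∀ v, v ≠ x → β v = α v) →
      D β ⊆ D α := by
    rintro α β x y hxy hα hβ ⟨p, q⟩ ⟨hpq, hne⟩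
    refine ⟨hpq, fun hαpq => ?_⟩
    have hyx : y ≠ x := fun e => hα (by rw [e])
    dsimp only at *
    by_cases hp : p = x
    · subst hp
      have hq : q ≠ p := fun e => hne (by rw [e])
      have hqy : q ≠ y := fun e => hα (by rw [hαpq, e])
      have := hγ p y q hxy hpq
      tauto
    · by_cases hq : q = x
      · subst hq
        have hpy : p ≠ y := fun e => hα (by rw [← hαpq, e])
        have := hγ q y p hxy hpq.symm
        tauto
      · exact hne (by rw [hβ p hp, hβ q hq, hαpq])
  -- If `x` is alone in its `α`-class, its mate `y` can take the colour of `x`, as the two are not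
  -- adjacent.
  have hsingle : ∀ (α : G.Coloring C) (x y), γ x = γ y → α x ≠ α y → (∀ z, α z = α x → z = x) →
      ∃ β, Recolours α β ∧ (D β).ncard < (D α).ncard := by
    intro α x y hxy hα hx
    let c : V → C := Function.update α y (α x)
    have hcy : c y = α x := Function.update_self (β := fun _ => C) ..
    have hc : ∀ v, v ≠ y → c v = α v := fun v hv =>
      Function.update_of_ne (β := fun _ => C) hv ..
    have hxy' : ¬ G.Adj x y := fun h => γ.valid h hxy
    let β : G.Coloring C := Coloring.mk c (by
      intro u v huv
      by_cases hu : u = y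
      · subst hu
        rw [hcy, hc v huv.ne']
        intro e
        rw [hx v e.symm] at huv
        exact hxy' huv.symm
      · by_cases hv : v = y
        · subst hv
          rw [hcy, hc u hu]
          intro e
          rw [hx u e] at huv
          exact hxy' huv
        · rw [hc u hu, hc v hv]; exact α.valid huv)
    refine ⟨β, Relation.ReflTransGen.single ⟨y, fun w hw => (hc w hw).symm⟩,
      Set.ncard_lt_ncard ⟨hD α β y x hxy.symm hα.symm hc, fun hs => ?_⟩ (Set.toFinite _)⟩
    have hmem : (x, y) ∈ D α := ⟨hxy, hα⟩
    refine (hs hmem).2 ?_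
    exact (hc x fun e => hα (by rw [e])).trans hcy.symm
  induction hm : (D α).ncard using Nat.strong_induction_on generalizing α with
  | _ m ih =>
    by_cases hdis : ∃ x y, γ x = γ y ∧ α x ≠ α y
    · obtain ⟨β, hαβ, hlt⟩ : ∃ β, Recolours α β ∧ (D β).ncard < (D α).ncard := by
        by_cases hs : ∃ x y, γ x = γ y ∧ α x ≠ α y ∧ ∀ z, α z = α x → z = x
        · obtain ⟨x, y, hxy, hα, hx⟩ := hs
          exact hsingle α x y hxy hα hx
        · push Not at hs
          -- Otherwise `α` uses at most `n < |C|` colours. Giving `x` a free colour makes it alone,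
          -- and the previous case applies.
          have hle := Set.ncard_range_le_of_fibers γ α hγ (by
            intro x y hyx hγyx
            by_cases hα : α y = α x
            · exact ⟨y, hyx, hα⟩
            · obtain ⟨z, hz, hzx⟩ := hs x y hγyx.symm fun e => hα e.symm
              exact ⟨z, hzx, hz⟩)
          obtain ⟨c₀, hc₀⟩ : ∃ c, c ∉ Set.range α := by
            by_contra! hall
            rw [Set.eq_univ_of_forall hall, Set.ncard_univ] at hle
            lia
          have hc₀' : ∀ v, α v ≠ c₀ := fun v hv => hc₀ ⟨v, hv⟩
          obtain ⟨x, y, hxy, hα⟩ := hdis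
          let c : V → C := Function.update α x c₀
          have hcx : c x = c₀ := Function.update_self (β := fun _ => C) ..
          have hc : ∀ v, v ≠ x → c v = α v := fun v hv =>
            Function.update_of_ne (β := fun _ => C) hv ..
          let β : G.Coloring C := Coloring.mk c (by
            intro u v huv
            by_cases hu : u = x
            · subst hu
              rw [hcx, hc v huv.ne']
              exact (hc₀' v).symm
            · by_cases hv : v = x
              · subst hv
                rw [hcx, hc u hu]
                exact hc₀' u
              · rw [hc u hu, hc v hv]; exact α.valid huv)
          have hβx : β x = c₀ := hcx
          have hβ : ∀ v, v ≠ x → β v = α v := hc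
          have hαβ : Recolours α β := Relation.ReflTransGen.single ⟨x, fun w hw => (hβ w hw).symm⟩
          obtain ⟨β', hββ', hlt⟩ := hsingle β x y hxy
            (by rw [hβx, hβ y fun e => hα (by rw [e])]; exact (hc₀' y).symm)
            (fun z hz => by
              by_contra hzx
              rw [hβx, hβ z hzx] at hz
              exact hc₀' z hz)
          exact ⟨β', hαβ.trans hββ', hlt.trans_le
            (Set.ncard_le_ncard (hD α β x y hxy hα hβ) (Set.toFinite _))⟩
      obtain ⟨f, hf⟩ := ih _ (hm ▸ hlt) β rfl
      exact ⟨f, hαβ.trans hf⟩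
    · push Not at hdis
      -- Here `α` is constant on `γ`-classes, so it factors through `γ`; the factor is injective
      -- because `α` too needs at least `n` colours.
      have hsurj : Function.Surjective γ := by
        rw [← Set.range_eq_univ]
        refine Set.eq_of_subset_of_ncard_le (Set.subset_univ _) ?_
        rw [Set.ncard_univ, Nat.card_fin]
        exact γ.le_ncard_range hmin
      choose g hg using hsurj
      have hfγ : ∀ v, α (g (γ v)) = α v := fun v => hdis _ _ (hg _)
      have hinj : Function.Injective fun k => α (g k) := by
        have hrange : Set.range α ⊆ Set.range fun k => α (g k) := by
          rintro _ ⟨v, rfl⟩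
          exact ⟨γ v, hfγ v⟩
        have hle := (α.le_ncard_range hmin).trans (Set.ncard_le_ncard hrange (Set.toFinite _))
        rw [← Set.injOn_univ, ← Set.ncard_image_iff (Set.toFinite _), Set.image_univ]
        refine le_antisymm ?_ (by rwa [Set.ncard_univ, Nat.card_fin])
        rw [← Set.image_univ]
        exact Set.ncard_image_le (Set.toFinite _)
      refine ⟨⟨_, hinj⟩, ?_⟩
      convert Recolours.refl α
      exact DFunLike.ext _ _ hfγ

/-! ### Decomposing `P₄`-free graphs. -/

/-- One step of the induction in `exists_split_of_pathFree`. -/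
lemma exists_split_insert [DecidableEq V]
    (h : ∀ a b c d, G.Adj a b → G.Adj b c → G.Adj c d → ¬ G.Adj a c → ¬ G.Adj b d →
      ¬ G.Adj a d → False)
    {v : V} {s t : Finset V} (hs : s.Nonempty) (ht : t.Nonempty) (hvs : v ∉ s) (hvt : v ∉ t)
    (hst : Disjoint s t) (hG : ∀ u ∈ s, ∀ w ∈ t, ¬ G.Adj u w) :
    ∃ s' t' : Finset V, s'.Nonempty ∧ t'.Nonempty ∧ s' ∪ t' = insert v (s ∪ t) ∧ Disjoint s' t' ∧
      ((∀ u ∈ s', ∀ w ∈ t', ¬ G.Adj u w) ∨ (∀ u ∈ s', ∀ w ∈ t', G.Adj u w)) := by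
  classical
  by_cases hv : ∀ u ∈ s ∪ t, G.Adj v u
  · refine ⟨{v}, s ∪ t, by simp, hs.mono Finset.subset_union_left, by ext; simp, by simp [hvs, hvt],
      Or.inr ?_⟩
    simpa using hv
  wlog hvs' : ∃ u ∈ s, ¬ G.Adj v u generalizing s t with H
  · have := H ht hs hvt hvs hst.symm (fun u hu w hw h => hG w hw u hu h.symm)
      (by rwa [Finset.union_comm]) (by
        push Not at hv
        obtain ⟨u, hu, hvu⟩ := hv
        exact ⟨u, (Finset.mem_union.mp hu).resolve_left fun hus => hvs' ⟨u, hus, hvu⟩, hvu⟩)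
    rwa [Finset.union_comm t s] at this
  obtain ⟨y, hys, hvy⟩ := hvs'
  by_cases htv : ∃ z ∈ t, G.Adj v z
  · obtain ⟨z, hz, hvz⟩ := htv
    -- The non-neighbours of `v` in `s` split off: an edge from such a `u` to a neighbour `w` of `v`
    -- in `s` would give the induced path `u w v z`.
    refine ⟨s.filter fun u => ¬ G.Adj v u, insert v (s.filter (fun u => G.Adj v u) ∪ t),
      ⟨y, by simp [hys, hvy]⟩, by simp, ?_, ?_, Or.inl ?_⟩
    · ext u; simp; tauto
    · rw [Finset.disjoint_left] at hst ⊢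
      intro u hu
      have := @hst u
      simp at hu ⊢
      refine ⟨?_, ?_⟩
      · rintro rfl; exact hvs hu.1
      · tauto
    · intro u hu w hw huw
      simp only [Finset.mem_filter, Finset.mem_insert, Finset.mem_union] at hu hw
      rcases hw with rfl | ⟨hw, hvw⟩ | hw
      · exact hu.2 huw.symm
      · exact h u w v z huw hvw.symm hvz (fun h => hu.2 h.symm) (hG w hw z hz) (hG u hu.1 z hz)
      · exact hG u hu.1 w hw huw
  · push Not at htv
    refine ⟨t, insert v s, ht, by simp, by ext; simp; tauto, ?_, Or.inl ?_⟩
    · rw [Finset.disjoint_insert_right]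
      exact ⟨hvt, hst.symm⟩
    · intro u hu w hw huw
      rcases Finset.mem_insert.mp hw with rfl | hw
      · exact htv u hu huw.symm
      · exact hG w hw u hu huw.symm

/-- The vertex set of a graph without induced paths on four vertices can be split into two parts
with either no edges or all edges between them. -/
lemma exists_split_of_pathFree [DecidableEq V]
    (h : ∀ a b c d, G.Adj a b → G.Adj b c → G.Adj c d → ¬ G.Adj a c → ¬ G.Adj b d →
      ¬ G.Adj a d → False) (A : Finset V) (hA : A.Nontrivial) :
    ∃ s t : Finset V, s.Nonempty ∧ t.Nonempty ∧ s ∪ t = A ∧ Disjoint s t ∧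
      ((∀ u ∈ s, ∀ w ∈ t, ¬ G.Adj u w) ∨ (∀ u ∈ s, ∀ w ∈ t, G.Adj u w)) := by
  induction A using Finset.induction_on with
  | empty => exact (Finset.not_nontrivial_empty hA).elim
  | insert v B hvB ih =>
    by_cases hB : B.Nontrivial
    · obtain ⟨s, t, hs, ht, rfl, hst, hG⟩ := ih hB
      rw [Finset.mem_union, not_or] at hvB
      rcases hG with hG | hG
      · exact exists_split_insert h hs ht hvB.1 hvB.2 hst hG
      -- `P₄` is self-complementary: an induced path `a b c d` of `Gᶜ` is the induced path `b d a c`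
      -- of `G`.
      · obtain ⟨s', t', hs', ht', hst', hdis, hG'⟩ := exists_split_insert (G := Gᶜ) (by
            simp only [compl_adj]
            intro a b c d hab hbc hcd hac hbd had
            have := h b d a c
            have := G.adj_comm
            grind) hs ht hvB.1 hvB.2 hst
          (fun u hu w hw h => h.2 (hG u hu w hw))
        refine ⟨s', t', hs', ht', hst', hdis, hG'.symm.imp (fun h u hu w hw => (h u hu w hw).2)
          fun h u hu w hw => ?_⟩
        by_contra hn
        exact h u hu w hw ⟨fun e => Finset.disjoint_left.mp hdis hu (e ▸ hw), hn⟩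
    · obtain ⟨b, hb⟩ : B.Nonempty := by
        rw [Finset.nonempty_iff_ne_empty]
        rintro rfl
        simp at hA
      have hB : B = {b} := by
        refine Finset.eq_singleton_iff_unique_mem.mpr ⟨hb, fun x hx => ?_⟩
        by_contra hxb
        exact hB ⟨x, hx, b, hb, hxb⟩
      subst hB
      refine ⟨{v}, {b}, by simp, by simp, by ext; simp, by simpa using hvB, ?_⟩
      simpa using (em _).symm

/-- Graphs without induced paths on four vertices are recolourable. -/
lemma isRecolourable_of_pathFree [Finite V]
    (h : ∀ a b c d, G.Adj a b → G.Adj b c → G.Adj c d → ¬ G.Adj a c → ¬ G.Adj b d →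
      ¬ G.Adj a d → False) : G.IsRecolourable := by
  classical
  induction hn : Nat.card V using Nat.strong_induction_on generalizing V with
  | _ n ih =>
    rcases subsingleton_or_nontrivial V with hV | hV
    · exact isRecolourable_of_subsingleton
    have := Fintype.ofFinite V
    obtain ⟨s, t, ⟨x, hx⟩, ⟨y, hy⟩, hst, hdis, hG⟩ :=
      exists_split_of_pathFree h Finset.univ Finset.univ_nontrivial
    have hmem : ∀ v, v ∈ t ↔ v ∉ s := fun v =>
      ⟨fun hv hvs => Finset.disjoint_left.mp hdis hvs hv, fun hv =>
        (Finset.mem_union.mp (hst ▸ Finset.mem_univ v)).resolve_left hv⟩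
    have h₁ : (G.induce (s : Set V)).IsRecolourable :=
      ih _ (hn ▸ Finite.card_subtype_lt (x := y) ((hmem y).mp hy))
        (fun a b c d => h a b c d) rfl
    have h₂ : (G.induce (s : Set V)ᶜ).IsRecolourable :=
      ih _ (hn ▸ Finite.card_subtype_lt (x := x) (not_not.mpr hx))
        (fun a b c d => h a b c d) rfl
    rcases hG with hG | hG
    · exact isRecolourable_of_disjoint_parts
        (fun u hu v hv => hG u hu v ((hmem v).mpr hv)) h₁ h₂
    · exact isRecolourable_of_join (fun u hu v hv => hG u hu v ((hmem v).mpr hv)) h₁ h₂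

/-! ### Graphs without an induced `P₃ + P₁`. -/

/-- A graph without an induced disjoint union of a path on three vertices and a vertex, which is
not a join and has an independent set of size three, is a disjoint union of complete graphs. -/
lemma adj_trans_of_not_join
    (h : ∀ a b c d, G.Adj a b → G.Adj b c → a ≠ c → ¬ G.Adj a c → d ≠ a → d ≠ b → d ≠ c →
      ¬ G.Adj d a → ¬ G.Adj d b → ¬ G.Adj d c → False)
    (hjoin : ∀ s : Set V, s.Nonempty → (∀ u ∈ s, ∀ v, v ≠ u → ¬ G.Adj u v → v ∈ s) → ∀ v, v ∈ s)
    {x y z : V} (hxy : x ≠ y) (hxz : x ≠ z) (hyz : y ≠ z) (hxy' : ¬ G.Adj x y)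
    (hxz' : ¬ G.Adj x z) (hyz' : ¬ G.Adj y z) {a b c : V} (hab : G.Adj a b) (hbc : G.Adj b c)
    (hac : a ≠ c) : G.Adj a c := by
  have hsymm : ∀ u v, G.Adj u v ↔ G.Adj v u := fun u v => G.adj_comm u v
  have hirr : ∀ u, ¬ G.Adj u u := fun u => G.loopless.irrefl u
  -- `hjoin` says that the complement is connected, so a property closed under non-adjacency spreads
  -- to all vertices. Lying in an independent triple is such a property.
  have htriple : ∀ u, ∃ v w, u ≠ v ∧ u ≠ w ∧ v ≠ w ∧ ¬ G.Adj u v ∧ ¬ G.Adj u w ∧ ¬ G.Adj v w := by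
    refine hjoin _ ⟨x, y, z, hxy, hxz, hyz, hxy', hxz', hyz'⟩ ?_
    rintro u ⟨v, w, huv, huw, hvw, huv', huw', hvw'⟩ p hpu hup
    by_cases hpv : p = v
    · exact ⟨u, w, by grind⟩
    by_cases hpw : p = w
    · exact ⟨u, v, by grind⟩
    by_cases h1 : G.Adj p v
    · by_cases h2 : G.Adj p w
      · exact (h v p w u h1.symm h2 hvw hvw' (by grind) (by grind) (by grind) (by grind) (by grind)
          (by grind)).elim
      · exact ⟨u, w, by grind⟩
    · exact ⟨u, v, by grind⟩
  by_contra hac'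
  -- If `a` and `c` were not adjacent, this set would contain `a`. It is closed under non-adjacency,
  -- so it would contain `b`, which it excludes.
  have hmem : b ∈ {u | u ≠ b ∧ G.Adj u b ∧ ∃ w, w ≠ u ∧ ¬ G.Adj u w ∧ G.Adj w b} := by
    refine hjoin {u | u ≠ b ∧ G.Adj u b ∧ ∃ w, w ≠ u ∧ ¬ G.Adj u w ∧ G.Adj w b}
      ⟨a, hab.ne, hab, c, hac.symm, hac', hbc.symm⟩ ?_ b
    rintro u ⟨hub, hub', w, hwu, huw, hwb⟩ p hpu hup
    -- The pair `u`, `w` extends to an independent triple, and `t` must then also be adjacent to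
    -- `b`. If `p` missed both `u` and `b`, one of `w p t + u`, `u b t + p`, `u b w + p` would be an
    -- induced `P₃ + P₁`.
    obtain ⟨t, htu, htw, htu', htw'⟩ : ∃ t, t ≠ u ∧ t ≠ w ∧ ¬ G.Adj t u ∧ ¬ G.Adj t w := by
      obtain ⟨v, v', h1, h2, h3, h4, h5, h6⟩ := htriple u
      by_cases hwv : w = v
      · exact ⟨v', by grind⟩
      by_cases hwv' : w = v'
      · exact ⟨v, by grind⟩
      by_cases hA : G.Adj w v
      · by_cases hB : G.Adj w v'
        · exact (h v w v' u hA.symm hB h3 h6 (by grind) (by grind) (by grind) (by grind) (by grind)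
            (by grind)).elim
        · exact ⟨v', by grind⟩
      · exact ⟨v, by grind⟩
    have hbt : b ≠ t := by grind
    have htb : G.Adj t b := by
      by_contra hn
      exact h u b w t hub' hwb.symm hwu.symm huw (by grind) (by grind) (by grind) (by grind)
        (by grind) (by grind)
    have hpb : p ≠ b := by grind
    by_cases hpb' : G.Adj p b
    · exact ⟨hpb, hpb', u, hpu.symm, by grind, hub'⟩
    · exfalso
      have hpw : p ≠ w := by grind
      have hpt : p ≠ t := by grind
      by_cases h1 : G.Adj p w
      · by_cases h2 : G.Adj p t
        · exact h w p t u h1.symm h2 (by grind) (by grind) (by grind) (by grind) (by grind)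
            (by grind) (by grind) (by grind)
        · exact h u b t p hub' htb.symm (by grind) (by grind) (by grind) (by grind) (by grind)
            (by grind) (by grind) (by grind)
      · exact h u b w p hub' hwb.symm (by grind) (by grind) (by grind) (by grind) (by grind)
            (by grind) (by grind) (by grind)
  exact hmem.1 rfl

/-- Graphs without an induced disjoint union of a path on three vertices and a vertex are
recolourable. -/
lemma isRecolourable_of_pathSumFree [Finite V]
    (h : ∀ a b c d, G.Adj a b → G.Adj b c → a ≠ c → ¬ G.Adj a c → d ≠ a → d ≠ b → d ≠ c →
      ¬ G.Adj d a → ¬ G.Adj d b → ¬ G.Adj d c → False) : G.IsRecolourable := by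
  classical
  induction hn : Nat.card V using Nat.strong_induction_on generalizing V with
  | _ n ih =>
    by_cases hjoin : ∃ s : Set V, s.Nonempty ∧ sᶜ.Nonempty ∧ ∀ u ∈ s, ∀ v ∉ s, G.Adj u v
    · obtain ⟨s, ⟨x, hx⟩, ⟨y, hy⟩, hs⟩ := hjoin
      have hind : ∀ t : Set V, ∀ a b c d : t, (G.induce t).Adj a b → (G.induce t).Adj b c →
          a ≠ c → ¬ (G.induce t).Adj a c → d ≠ a → d ≠ b → d ≠ c → ¬ (G.induce t).Adj d a →
          ¬ (G.induce t).Adj d b → ¬ (G.induce t).Adj d c → False :=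
        fun t a b c d h1 h2 h3 h4 h5 h6 h7 => h a b c d h1 h2 (Subtype.coe_ne_coe.mpr h3) h4
          (Subtype.coe_ne_coe.mpr h5) (Subtype.coe_ne_coe.mpr h6) (Subtype.coe_ne_coe.mpr h7)
      exact isRecolourable_of_join hs
        (ih _ (hn ▸ Finite.card_subtype_lt (x := y) hy) (hind s) rfl)
        (ih _ (hn ▸ Finite.card_subtype_lt (x := x) (not_not.mpr hx)) (hind sᶜ) rfl)
    · by_cases htriple : ∃ x y z, x ≠ y ∧ x ≠ z ∧ y ≠ z ∧ ¬ G.Adj x y ∧ ¬ G.Adj x z ∧ ¬ G.Adj y z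
      · obtain ⟨x, y, z, h1, h2, h3, h4, h5, h6⟩ := htriple
        refine isRecolourable_of_pathFree fun a b c d hab hbc hcd hac _ had => hac ?_
        refine adj_trans_of_not_join h (fun s hs hcl v => ?_) h1 h2 h3 h4 h5 h6 hab hbc ?_
        · by_contra hv
          refine hjoin ⟨s, hs, ⟨v, hv⟩, fun u hu w hw => ?_⟩
          by_contra huw
          exact hw (hcl u hu w (fun e => hw (e ▸ hu)) huw)
        · rintro rfl
          exact had hcd
      · refine isRecolourable_of_no_independent_triple fun x y z h1 h2 h3 => ?_
        by_contra! h4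
        exact htriple ⟨x, y, z, h1, h2, h3, h4⟩

end Classes

/-! ### Frozen colourings. -/

/-- A graph with a colouring in which no vertex can be recoloured is not mixing, as soon as there
is a second colouring. -/
lemma not_isMixing_of_frozen {V : Type*} {G : SimpleGraph V} {k : ℕ} (α β : G.Coloring (Fin k))
    (hne : α ≠ β) (hα : ∀ v c, c ≠ α v → ∃ w, G.Adj v w ∧ α w = c) : ¬ G.IsMixing k := by
  intro h
  have : Nontrivial (G.Coloring (Fin k)) := ⟨α, β, hne⟩
  obtain ⟨δ, v, hv, huniq⟩ := h.preconnected.exists_adj_of_nontrivial α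
  obtain ⟨w, hvw, hw⟩ := hα v (δ v) hv.symm
  have hwv : w = v := by
    by_contra hwv
    have : α w = δ w := by
      by_contra hn
      exact hwv (huniq w hn)
    exact δ.valid hvw (hw.symm.trans this)
  exact hvw.ne hwv.symm

/-- A graph `F` with a frozen colouring that uses more colours than necessary contains every graph
`H` such that the `H`-free graphs are mixing. -/
lemma isIndContained_of_frozen.{u} {W : Type*} {X : Type} [Finite X] {H : SimpleGraph W}
    (hH : ∀ (V : Type u) [Finite V] (G : SimpleGraph V), G.IsInducedFree H →
        ∀ ℓ : ℕ, G.chromaticNumber + 1 ≤ (ℓ : ℕ∞) → G.IsMixing ℓ)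
    (F : SimpleGraph X) {k : ℕ} (hk : F.Colorable k) (α β : F.Coloring (Fin (k + 1)))
    (hne : α ≠ β) (hα : ∀ v c, c ≠ α v → ∃ w, F.Adj v w ∧ α w = c) : H.IsIndContained F := by
  by_contra hfree
  -- `hH` only speaks of graphs in universe `u`, so `F` is lifted there.
  let e : F.comap (ULift.down.{u} : ULift X → X) ≃g F := Iso.comap Equiv.ulift F
  refine not_isMixing_of_frozen (α.comp e.toHom) (β.comp e.toHom) ?_ ?_
    (hH (ULift X) (F.comap ULift.down) (fun h => hfree (h.trans ⟨e.toEmbedding⟩)) (k + 1) ?_)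
  · intro h
    exact hne (DFunLike.ext _ _ fun x => DFunLike.congr_fun h (ULift.up x))
  · intro v c hc
    obtain ⟨w, hw⟩ := hα v.down c hc
    exact ⟨ULift.up w, hw⟩
  · obtain ⟨γ⟩ := hk
    have h : (F.comap (ULift.down.{u} : ULift X → X)).chromaticNumber ≤ k :=
      chromaticNumber_le_iff_colorable.mpr ⟨γ.comp e.toHom⟩
    push_cast
    gcongr

/-- The graph whose vertices are the ten half-edges of the complete graph on four vertices with
one edge removed, the half-edges `2 * i` and `2 * i + 1` forming an edge. Two of them are adjacent
if they belong to different edges and different vertices. -/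
def halfEdgeGraph : SimpleGraph (Fin 10) where
  Adj i j := i.val / 2 ≠ j.val / 2 ∧
    (![0, 1, 0, 2, 0, 3, 1, 2, 1, 3] : Fin 10 → Fin 4) i ≠ ![0, 1, 0, 2, 0, 3, 1, 2, 1, 3] j
  symm := ⟨fun _ _ h => ⟨h.1.symm, h.2.symm⟩⟩
  loopless := ⟨fun _ h => h.1 rfl⟩

instance : DecidableRel halfEdgeGraph.Adj := fun i j =>
  inferInstanceAs (Decidable (i.val / 2 ≠ j.val / 2 ∧ _ ≠ _))

/-- `halfEdgeGraph` has no two independent edges. -/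
lemma halfEdgeGraph_adj_of_edges : ∀ a b : Fin 10, halfEdgeGraph.Adj a b →
    ∀ c, ¬ halfEdgeGraph.Adj a c → ¬ halfEdgeGraph.Adj b c →
    ∀ d, halfEdgeGraph.Adj c d → ¬ halfEdgeGraph.Adj a d → halfEdgeGraph.Adj b d := by
  decide

/-! ### Small induced subgraphs. -/

section Main

variable {W : Type*} {H : SimpleGraph W}

/-- An induced subgraph of the cycle on six vertices without two independent edges avoids two
vertices at distance at most two, and so embeds into one of the two graphs that remain. -/
lemma isIndContained_path_or_pathSum (f : H ↪g cycleGraph 6)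
    (hH : ∀ a b c d, H.Adj a b → H.Adj c d → ¬ H.Adj a c → ¬ H.Adj a d → ¬ H.Adj b c →
      H.Adj b d) :
    H.IsIndContained (pathGraph 4) ∨ H.IsIndContained (pathGraph 3 ⊕g pathGraph 1) := by
  classical
  have hcases : ∀ p : Fin 6 → Bool, (∀ a b c d, p a → p b → p c → p d → (cycleGraph 6).Adj a b →
      (cycleGraph 6).Adj c d → ¬ (cycleGraph 6).Adj a c → ¬ (cycleGraph 6).Adj a d →
      ¬ (cycleGraph 6).Adj b c → (cycleGraph 6).Adj b d) →
      ∃ v, p v = false ∧ (p (v + 1) = false ∨ p (v + 2) = false) := by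
    intro p hp
    -- The three pairs of opposite edges of the cycle. If no two vertices at distance at most two
    -- are missing, at most an antipodal pair is, and one of these pairs of edges survives.
    have h1 := hp 0 1 3 4
    have h2 := hp 1 2 4 5
    have h3 := hp 2 3 5 0
    have e : ∀ i j : Fin 6, (cycleGraph 6).Adj i j ↔ (i = j + 1 ∨ j = i + 1) := by decide
    simp only [e] at h1 h2 h3
    by_contra! hn
    have n0 := hn 0
    have n1 := hn 1
    have n2 := hn 2
    have n3 := hn 3
    have n4 := hn 4
    have n5 := hn 5
    revert h1 h2 h3 n0 n1 n2 n3 n4 n5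
    simp
    cases p 0 <;> cases p 1 <;> cases p 2 <;> cases p 3 <;> cases p 4 <;> cases p 5 <;> simp
  obtain ⟨v, hv, hv'⟩ := hcases (fun i => decide (∃ a, f a = i)) (by
    intro a b c d ha hb hc hd
    obtain ⟨a, rfl⟩ := of_decide_eq_true ha
    obtain ⟨b, rfl⟩ := of_decide_eq_true hb
    obtain ⟨c, rfl⟩ := of_decide_eq_true hc
    obtain ⟨d, rfl⟩ := of_decide_eq_true hd
    simp only [f.map_adj_iff]
    exact hH a b c d)
  have hne : ∀ a, f a ≠ v := fun a ha => of_decide_eq_false hv ⟨a, ha⟩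
  rcases hv' with hv' | hv'
  · have hne' : ∀ a, f a ≠ v + 1 := fun a ha => of_decide_eq_false hv' ⟨a, ha⟩
    left
    -- After rotating `v` to 0, the missing vertices are 0 and 1, whose values here are dummies.
    let g : Fin 6 → Fin 4 := ![0, 0, 0, 1, 2, 3]
    have hg : ∀ v x y : Fin 6, x ≠ v → x ≠ v + 1 → y ≠ v → y ≠ v + 1 →
        (g (x - v) = g (y - v) → x = y) ∧
        ((pathGraph 4).Adj (g (x - v)) (g (y - v)) ↔ (cycleGraph 6).Adj x y) := by
      simp only [pathGraph_adj]
      decide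
    exact ⟨⟨⟨fun a => g (f a - v), fun a b hab =>
      f.injective ((hg v _ _ (hne a) (hne' a) (hne b) (hne' b)).1 hab)⟩, fun {a b} =>
      (hg v _ _ (hne a) (hne' a) (hne b) (hne' b)).2.trans f.map_adj_iff⟩⟩
  · have hne' : ∀ a, f a ≠ v + 2 := fun a ha => of_decide_eq_false hv' ⟨a, ha⟩
    right
    -- The missing vertices are now 0 and 2, with dummy values; vertex 1 becomes the isolated one.
    let g : Fin 6 → Fin 3 ⊕ Fin 1 := ![.inr 0, .inr 0, .inr 0, .inl 0, .inl 1, .inl 2]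
    have hg : ∀ v x y : Fin 6, x ≠ v → x ≠ v + 2 → y ≠ v → y ≠ v + 2 →
        (g (x - v) = g (y - v) → x = y) ∧
        ((pathGraph 3 ⊕g pathGraph 1).Adj (g (x - v)) (g (y - v)) ↔ (cycleGraph 6).Adj x y) := by
      have e : ∀ a b : Fin 3 ⊕ Fin 1, (pathGraph 3 ⊕g pathGraph 1).Adj a b ↔
          a = .inl 1 ∧ (b = .inl 0 ∨ b = .inl 2) ∨ b = .inl 1 ∧ (a = .inl 0 ∨ a = .inl 2) := by
        rintro (a | a) (b | b)
        · simp only [sum_adj_inl, pathGraph_adj]; revert a b; decide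
        · simp
        · simp
        · simp [Subsingleton.elim a b]
      simp only [e]
      decide
    exact ⟨⟨⟨fun a => g (f a - v), fun a b hab =>
      f.injective ((hg v _ _ (hne a) (hne' a) (hne b) (hne' b)).1 hab)⟩, fun {a b} =>
      (hg v _ _ (hne a) (hne' a) (hne b) (hne' b)).2.trans f.map_adj_iff⟩⟩

variable {V : Type*} {G : SimpleGraph V}

lemma path_four_isIndContained {a b c d : V} (hab : G.Adj a b) (hbc : G.Adj b c) (hcd : G.Adj c d)
    (hac : ¬ G.Adj a c) (hbd : ¬ G.Adj b d) (had : ¬ G.Adj a d) :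
    (pathGraph 4).IsIndContained G := by
  have hsymm : ∀ u v, G.Adj u v ↔ G.Adj v u := fun u v => G.adj_comm u v
  have hirr : ∀ u, ¬ G.Adj u u := fun u => G.loopless.irrefl u
  refine ⟨⟨⟨![a, b, c, d], fun i j => ?_⟩, fun {i j} => ?_⟩⟩
  · fin_cases i <;> fin_cases j <;> simp <;> grind
  · rw [pathGraph_adj]
    change G.Adj (![a, b, c, d] i) (![a, b, c, d] j) ↔ _
    fin_cases i <;> fin_cases j <;> simp <;> grind

lemma pathSum_isIndContained {a b c d : V} (hab : G.Adj a b) (hbc : G.Adj b c) (hac : a ≠ c)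
    (hac' : ¬ G.Adj a c) (hda : d ≠ a) (hdb : d ≠ b) (hdc : d ≠ c) (hda' : ¬ G.Adj d a)
    (hdb' : ¬ G.Adj d b) (hdc' : ¬ G.Adj d c) :
    (pathGraph 3 ⊕g pathGraph 1).IsIndContained G := by
  have hsymm : ∀ u v, G.Adj u v ↔ G.Adj v u := fun u v => G.adj_comm u v
  have hirr : ∀ u, ¬ G.Adj u u := fun u => G.loopless.irrefl u
  refine ⟨⟨⟨Sum.elim ![a, b, c] fun _ => d, fun i j => ?_⟩, fun {i j} => ?_⟩⟩
  · rcases i with i | i <;> rcases j with j | j <;> fin_cases i <;> fin_cases j <;> simp <;> grind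
  · change G.Adj (Sum.elim ![a, b, c] (fun _ => d) i) (Sum.elim ![a, b, c] (fun _ => d) j) ↔ _
    rcases i with i | i <;> rcases j with j | j <;> fin_cases i <;> fin_cases j <;>
      simp [pathGraph_adj] <;> grind

end Main

end SimpleGraph

open SimpleGraph

theorem theorem3 {W : Type*} [Finite W] (H : SimpleGraph W) :
    (∀ (V : Type*) [Finite V] (G : SimpleGraph V), G.IsInducedFree H →
        ∀ ℓ : ℕ, G.chromaticNumber + 1 ≤ (ℓ : ℕ∞) → G.IsMixing ℓ) ↔
      (H.IsIndContained (SimpleGraph.pathGraph 4) ∨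
        H.IsIndContained (SimpleGraph.pathGraph 3 ⊕g SimpleGraph.pathGraph 1)) := by
  constructor
  · intro h
    obtain ⟨f⟩ : H.IsIndContained (cycleGraph 6) := isIndContained_of_frozen h _ (k := 2)
      ⟨Coloring.mk ![0, 1, 0, 1, 0, 1] (by decide)⟩
      (Coloring.mk ![0, 1, 2, 0, 1, 2] (by decide))
      (Coloring.mk ![0, 1, 0, 1, 0, 1] (by decide))
      (fun h => absurd (DFunLike.congr_fun h 2) (by decide : (2 : Fin 3) ≠ 0))
      (by decide)
    obtain ⟨g⟩ : H.IsIndContained halfEdgeGraph := isIndContained_of_frozen h _ (k := 4)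
      ⟨Coloring.mk ![0, 1, 0, 2, 0, 3, 1, 2, 1, 3] (by decide)⟩
      -- Colouring by edges is frozen: every other edge has a half-edge at a different vertex.
      (Coloring.mk ![0, 0, 1, 1, 2, 2, 3, 3, 4, 4] (by decide))
      (Coloring.mk ![0, 1, 0, 2, 0, 3, 1, 2, 1, 3] (by decide))
      (fun h => absurd (DFunLike.congr_fun h 1) (by decide : (0 : Fin 5) ≠ 1))
      (by decide)
    refine isIndContained_path_or_pathSum f fun a b c d => ?_
    simp only [← g.map_adj_iff]
    exact fun hab hcd hac had hbc => halfEdgeGraph_adj_of_edges _ _ hab _ hac hbc _ hcd had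
  · rintro (h | h) V _ G hG ℓ hℓ
    · refine (isRecolourable_of_pathFree fun a b c d h1 h2 h3 h4 h5 h6 => hG ?_).isMixing hℓ
      exact h.trans (path_four_isIndContained h1 h2 h3 h4 h5 h6)
    · refine (isRecolourable_of_pathSumFree
        fun a b c d h1 h2 h3 h4 h5 h6 h7 h8 h9 h10 => hG ?_).isMixing hℓ
      exact h.trans (pathSum_isIndContained h1 h2 h3 h4 h5 h6 h7 h8 h9 h10)
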